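/- Let $(K,\partial_x)$ be a differential field containing $\mathbb{C}$ in its constants, and let $z=z(x)\in K$ be a non-constant rational Hamiltonian change of variable, i.e. $(z,w)$ with $w=\partial_x z\neq 0$ solves $\partial_x z=\partial H/\partial w$, $\partial_x w=-\partial H/\partial z$ for $H(z,w)=\tfrac{w^2}{2}+V(z)$ with some $V\in\mathbb{C}(z)$. Suppose $K=\mathbb{C}(z(x),\partial_x z(x))$ and $(\partial_x z)^2=\alpha(z(x))$ with $\alpha\in\mathbb{C}(z)$. Let $\widehat K=\mathbb{C}(z,\sqrt\alpha)$, a field generated over the rational function field $\mathbb{C}(z)$ by a square root $\sqrt\alpha$ of $\alpha$, where $\sqrt\alpha$ is the root corresponding to $\partial_x z$ (that is, if $\partial_x z=\beta(z(x))$ with $\beta\in\mathbb{C}(z)$, then $\sqrt\alpha=\beta$). Let $\partial_z$ be the $\mathbb{C}$-derivation of $\widehat K$ with $\partial_z z=1$, and $\widehat\partial_z=\sqrt\alpha\,\partial_z$. Then: 1. There is an isomorphism of differential fields $\varphi:(K,\partial_x)\to(\widehat K,\widehat\partial_z)$ over $\mathbb{C}$ with $\varphi(z(x))=z$ and $\varphi(\partial_x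 z)=\sqrt\alpha$. Moreover, let $A$ be any $n\times n$ matrix over $K$ and $\widehat A=\varphi(A)$ (in particular, $\widehat A$ may have entries $\widehat a_{ij}\in\mathbb{C}(z)$, and then $a_{ij}(x)=\widehat a_{ij}(z(x))$), and consider the systems $\partial_x\mathbf Y=-A\mathbf Y$ over $K$ and $\widehat\partial_z\widehat{\mathbf Y}=-\widehat A\widehat{\mathbf Y}$ over $\widehat K$. Let $L/K$ and $\widehat L/\widehat K$ be Picard–Vessiot extensions of these systems (differential field extensions with field of constants $\mathbb{C}$, generated by the entries of a fundamental matrix). $\mathrm{DGal}(L/F)$ denotes the group of automorphisms of $L$ that commute with the derivation and fix the subfield $F$ elementwise. For the group over $\mathbb{C}(z)$ the derivation of $\widehat L$ is $\partial_z=\tfrac1{\sqrt\alpha}\widehat\partial_z$ (the statements hold as well with $\widehat\partial_z$). $G^0$ denotes the identity component of $G$ in the Zariski topology. Then there is an isomorphism of differential fields $\Phi:L\to\widehat L$ extending $\varphi$, and $\sigma\mapsto\Phi\sigma\Phi^{-1}$ induces the group isomorphisms in 2 and 3: 2. $\mathrm{DGal}(L/K)\simeq\mathrm{DGal}(\widehat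 L/\widehat K)\subseteq\mathrm{DGal}(\widehat L/\mathbb{C}(z))$; 3. $(\mathrm{DGal}(L/K))^0\simeq(\mathrm{DGal}(\widehat L/\mathbb{C}(z)))^0$. 4. The eigenrings $\mathcal E(A)=\{P\in M_n(K):\partial_xP=PA-AP\}$ and $\mathcal E(\widehat A)=\{\widehat P\in M_n(\widehat K):\widehat\partial_z\widehat P=\widehat P\widehat A-\widehat A\widehat P\}$ are isomorphic $\mathbb{C}$-algebras, through $P\mapsto\varphi(P)$. -/

import Mathlib

/-! ## Rational functions and Hamiltonian changes of variable -/

/-- The derivative `f' = d f / d z` of a rational function `f ∈ ℂ(z)` (quotient rule). -/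
noncomputable def ratDeriv (f : RatFunc ℂ) : RatFunc ℂ :=
  (algebraMap (Polynomial ℂ) (RatFunc ℂ)
      (Polynomial.derivative f.num * f.denom - f.num * Polynomial.derivative f.denom)) /
    (algebraMap (Polynomial ℂ) (RatFunc ℂ) f.denom) ^ 2

/-- The value `f(z)` of a rational function `f ∈ ℂ(z)` at an element `z` of a field over `ℂ`.
(The denominator does not vanish at `z` when `z` is transcendental over `ℂ`.) -/
noncomputable def ratEval {K : Type*} [Field K] [Algebra ℂ K] (z : K) (f : RatFunc ℂ) : K :=
  Polynomial.aeval z f.num / Polynomial.aeval z f.denom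

/-- `z` is a (non-constant) rational Hamiltonian change of variable in the differential field
`(K, ∂)`: the pair `(z, w)` with `w = ∂ z` solves the Hamiltonian system
`∂ z = ∂H/∂w = w`, `∂ w = -∂H/∂z = -V'(z)` of `H(z, w) = w² / 2 + V(z)`
for a rational potential `V`. -/
def IsRationalHamiltonianChange {K : Type*} [Field K] [Algebra ℂ K]
    (D : Derivation ℂ K K) (z : K) : Prop :=
  D z ≠ 0 ∧ ∃ (V : RatFunc ℂ) (w : K), D z = w ∧ D w = -ratEval z (ratDeriv V)

/-! ## Linear differential systems, Picard-Vessiot extensions, differential Galois groups -/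

/-- `Y` is a fundamental matrix, with entries in `(L, ∂)`, of the system `∂ Y = -A Y`
with coefficients in `K`. -/
def IsFundamentalMatrix {K L : Type*} [Field K] [Field L] [Algebra ℂ L] [Algebra K L] {n : ℕ}
    (A : Matrix (Fin n) (Fin n) K) (DL : Derivation ℂ L L) (Y : Matrix (Fin n) (Fin n) L) :
    Prop :=
  Y.det ≠ 0 ∧ Y.map DL = -(A.map (algebraMap K L)) * Y

/-- `(L, DL)` is a Picard-Vessiot extension of `(K, DK)` for the system `∂ Y = -A Y`:
a differential field extension without constants outside `ℂ`, generated as a field over `K`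
by the entries of a fundamental matrix. -/
structure IsPicardVessiot {K L : Type*} [Field K] [Algebra ℂ K] [Field L] [Algebra ℂ L]
    [Algebra K L] {n : ℕ} (DK : Derivation ℂ K K) (A : Matrix (Fin n) (Fin n) K)
    (DL : Derivation ℂ L L) : Prop where
  deriv_algebraMap : ∀ a : K, DL (algebraMap K L a) = algebraMap K L (DK a)
  constants : ∀ y : L, DL y = 0 → y ∈ (algebraMap ℂ L).range
  fundamental : ∃ Y : Matrix (Fin n) (Fin n) L, IsFundamentalMatrix A DL Y ∧
    IntermediateField.adjoin K (Set.range fun p : Fin n × Fin n => Y p.1 p.2) = ⊤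

/-- The differential Galois group of `(L, D)` over a subfield `F`: all automorphisms of the
field `L` that commute with `D` and fix every element of `F`. -/
def DGal {L : Type*} [Field L] [Algebra ℂ L] (D : Derivation ℂ L L) (F : Subfield L) :
    Subgroup (RingAut L) where
  carrier := {σ | (∀ y, σ (D y) = D (σ y)) ∧ ∀ a ∈ F, σ a = a}
  mul_mem' := by
    rintro σ τ ⟨h1, h2⟩ ⟨h3, h4⟩
    refine ⟨fun y => ?_, fun a ha => ?_⟩
    · simp only [RingAut.mul_apply, h3, h1]
    · simp only [RingAut.mul_apply, h4 a ha, h2 a ha]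
  one_mem' := ⟨fun _ => rfl, fun _ _ => rfl⟩
  inv_mem' := by
    rintro σ ⟨h1, h2⟩
    refine ⟨fun y => ?_, fun a ha => ?_⟩
    · apply σ.injective
      change σ (σ.symm (D y)) = σ (D (σ.symm y))
      rw [h1, RingEquiv.apply_symm_apply, RingEquiv.apply_symm_apply]
    · apply σ.injective
      change σ (σ.symm a) = σ a
      rw [RingEquiv.apply_symm_apply, h2 a ha]

/-! ## The Zariski topology on groups of automorphisms, and identity components -/

/-- The Zariski topology on affine space `k ^ ι`: the basic open sets are the sets `P ≠ 0`. -/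
@[reducible]
def zariskiAffine (ι k : Type*) [Field k] : TopologicalSpace (ι → k) :=
  TopologicalSpace.generateFrom
    {U | ∃ P : MvPolynomial ι k, U = {x | MvPolynomial.eval x P ≠ 0}}

/-- The Zariski topology on the automorphisms of a field `L`: the sets
`{σ | P (σ a₁, …, σ aₘ) = 0}`, for `aᵢ ∈ L` and polynomials `P` over `L`, are closed.
On the differential Galois group of a Picard-Vessiot extension this is the topology of the
algebraic group of matrices that represents it; see `zariskiAut_eq_matrix`. -/
@[reducible]
def zariskiAut (L : Type*) [Field L] : TopologicalSpace (RingAut L) :=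
  TopologicalSpace.generateFrom
    {U | ∃ (m : ℕ) (a : Fin m → L) (P : MvPolynomial (Fin m) L),
      U = {σ | MvPolynomial.eval (fun i => σ (a i)) P ≠ 0}}

theorem continuous_mul_left_zariskiAut {L : Type*} [Field L] (g : RingAut L) :
    @Continuous _ _ (zariskiAut L) (zariskiAut L) (fun σ : RingAut L => g * σ) := by
  let _ := zariskiAut L
  refine continuous_generateFrom_iff.2 ?_
  rintro _ ⟨m, a, P, rfl⟩
  refine TopologicalSpace.isOpen_generateFrom_of_mem
    ⟨m, a, P.map (g.symm : L →+* L), ?_⟩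
  ext σ
  simp only [Set.mem_preimage, Set.mem_ofPred_eq, RingAut.mul_apply, ne_eq]
  rw [not_iff_not, MvPolynomial.eval_map]
  have : MvPolynomial.eval (fun i => g (σ (a i))) P =
      g (MvPolynomial.eval₂ (g.symm : L →+* L) (fun i => σ (a i)) P) := by
    have h := MvPolynomial.eval₂_comp_left (g : L →+* L) (g.symm : L →+* L)
      (fun i => σ (a i)) P
    have h2 : (g : L →+* L).comp (g.symm : L →+* L) = RingHom.id L := by
      ext x; simp
    rw [h2] at h
    exact h.symm
  rw [this, map_eq_zero_iff _ g.injective]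

/-- The identity component `G⁰` of a group `G` of automorphisms of `L`: the connected
component of the identity for the Zariski topology of `G`. -/
def identityComponent {L : Type*} [Field L] (G : Subgroup (RingAut L)) :
    Subgroup (RingAut L) :=
  letI := zariskiAut L
  have key : ∀ g ∈ connectedComponentIn (G : Set (RingAut L)) 1,
      ∀ h ∈ connectedComponentIn (G : Set (RingAut L)) 1,
      g⁻¹ * h ∈ connectedComponentIn (G : Set (RingAut L)) 1 := by
    intro g hg h hh
    have hgG : g ∈ G := connectedComponentIn_subset _ _ hg
    have hpre : IsPreconnected
        ((fun σ => g⁻¹ * σ) '' connectedComponentIn (G : Set (RingAut L)) 1) :=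
      isPreconnected_connectedComponentIn.image _
        (continuous_mul_left_zariskiAut g⁻¹).continuousOn
    refine hpre.subset_connectedComponentIn ⟨g, hg, by simp⟩ ?_ ⟨h, hh, rfl⟩
    rintro _ ⟨σ, hσ, rfl⟩
    exact G.mul_mem (G.inv_mem hgG) (connectedComponentIn_subset _ _ hσ)
  have one : (1 : RingAut L) ∈ connectedComponentIn (G : Set (RingAut L)) 1 :=
    mem_connectedComponentIn G.one_mem
  have inv : ∀ g ∈ connectedComponentIn (G : Set (RingAut L)) 1,
      g⁻¹ ∈ connectedComponentIn (G : Set (RingAut L)) 1 := fun g hg => by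
    simpa using key g hg 1 one
  { carrier := connectedComponentIn (G : Set (RingAut L)) 1
    mul_mem' := fun {g h} hg hh => by simpa using key g⁻¹ (inv g hg) h hh
    one_mem' := one
    inv_mem' := fun {g} hg => inv g hg }

/-- For a Picard-Vessiot extension generated by a fundamental matrix `Y`, every `σ` in the
differential Galois group acts by `σ(Y) = Y M` with a (unique) matrix `M` over `ℂ`. -/
theorem exists_matrix_of_mem_DGal {K L : Type*} [Field K] [Algebra ℂ K] [Field L] [Algebra ℂ L]
    [Algebra K L] {n : ℕ} {DK : Derivation ℂ K K} {A : Matrix (Fin n) (Fin n) K}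
    {DL : Derivation ℂ L L} (h : IsPicardVessiot DK A DL)
    {Y : Matrix (Fin n) (Fin n) L} (hY : IsFundamentalMatrix A DL Y)
    {σ : RingAut L} (hσ : σ ∈ DGal DL (algebraMap K L).fieldRange) :
    ∃ M : Matrix (Fin n) (Fin n) ℂ, Y.map σ = Y * M.map (algebraMap ℂ L) := by
  obtain ⟨hdet, hD⟩ := hY
  have hu : IsUnit Y.det := isUnit_iff_ne_zero.2 hdet
  set N : Matrix (Fin n) (Fin n) L := Y⁻¹ * Y.map σ with hN
  have hYN : Y * N = Y.map σ := by rw [hN, Matrix.mul_nonsing_inv_cancel_left _ _ hu]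
  have hmul : ∀ P Q : Matrix (Fin n) (Fin n) L,
      (P * Q).map DL = P.map DL * Q + P * Q.map DL := by
    intro P Q
    ext i j
    simp only [Matrix.map_apply, Matrix.mul_apply, Matrix.add_apply, map_sum,
      Derivation.leibniz, smul_eq_mul, Finset.sum_add_distrib]
    rw [add_comm]
    congr 1
    exact Finset.sum_congr rfl fun k _ => mul_comm _ _
  have hσA : (A.map (algebraMap K L)).map σ = A.map (algebraMap K L) := by
    ext i j
    exact hσ.2 _ ⟨A i j, rfl⟩
  have h1 : (Y.map σ).map DL = (Y.map DL).map σ := by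
    ext i j
    exact (hσ.1 (Y i j)).symm
  have h2 : (Y.map DL).map σ = -(A.map (algebraMap K L)) * Y.map σ := by
    rw [hD, Matrix.neg_mul]
    ext i j
    have := congrFun (congrFun (Matrix.map_mul (L := A.map (algebraMap K L)) (M := Y)
      (f := (σ : L →+* L))) i) j
    simp only [Matrix.map_apply, Matrix.neg_apply, Matrix.neg_mul, map_neg] at this ⊢
    rw [← congrArg (fun Z : Matrix (Fin n) (Fin n) L => (Z * Y.map σ) i j) hσA]
    exact congrArg Neg.neg this
  have h3 : Y * N.map DL = 0 := by
    have h := hmul Y N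
    rw [hYN, h1, h2, hD, Matrix.mul_assoc, hYN] at h
    exact left_eq_add.1 h
  have h4 : N.map DL = 0 := by
    rw [← Matrix.nonsing_inv_mul_cancel_left Y (N.map DL) hu, h3, Matrix.mul_zero]
  choose f hf using fun i j => h.constants (N i j) (congrFun (congrFun h4 i) j)
  refine ⟨Matrix.of f, ?_⟩
  rw [← hYN]
  congr 1
  ext i j
  exact (hf i j).symm

/-- On the differential Galois group of a Picard-Vessiot extension, `zariskiAut` is the
Zariski topology of the group of matrices `M_σ`, `σ(Y) = Y M_σ`, for a fundamental matrix `Y`. -/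
theorem zariskiAut_eq_matrix {K L : Type*} [Field K] [Algebra ℂ K] [Field L] [Algebra ℂ L]
    [Algebra K L] {n : ℕ} {A : Matrix (Fin n) (Fin n) K}
    {DL : Derivation ℂ L L} {Y : Matrix (Fin n) (Fin n) L} (hY : IsFundamentalMatrix A DL Y)
    (hgen : IntermediateField.adjoin K (Set.range fun p : Fin n × Fin n => Y p.1 p.2) = ⊤)
    (ρ : DGal DL (algebraMap K L).fieldRange → Fin n × Fin n → ℂ)
    (hρ : ∀ σ, Y.map σ.1 = Y * (Matrix.of fun i j => algebraMap ℂ L (ρ σ (i, j)))) :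
    (zariskiAut L).induced Subtype.val = (zariskiAffine (Fin n × Fin n) ℂ).induced ρ := by
  obtain ⟨hdet, -⟩ := hY
  have hu : IsUnit Y.det := isUnit_iff_ne_zero.2 hdet
  have hent : ∀ σ i j, σ.1 (Y i j) = ∑ k, Y i k * algebraMap ℂ L (ρ σ (k, j)) := by
    intro σ i j
    have := congrFun (congrFun (hρ σ) i) j
    simpa [Matrix.mul_apply] using this
  -- every element of `L` moves by a rational function of the matrix entries
  have hrat : ∀ x : L, ∃ p q : MvPolynomial (Fin n × Fin n) L, ∀ σ,
      MvPolynomial.eval (fun t => algebraMap ℂ L (ρ σ t)) q ≠ 0 ∧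
      σ.1 x * MvPolynomial.eval (fun t => algebraMap ℂ L (ρ σ t)) q =
        MvPolynomial.eval (fun t => algebraMap ℂ L (ρ σ t)) p := by
    intro x
    have hx : x ∈ IntermediateField.adjoin K
        (Set.range fun p : Fin n × Fin n => Y p.1 p.2) := hgen ▸ IntermediateField.mem_top
    induction hx using IntermediateField.adjoin_induction with
    | mem x hx =>
      obtain ⟨⟨i, j⟩, rfl⟩ := hx
      refine ⟨∑ k, MvPolynomial.C (Y i k) * MvPolynomial.X (k, j), 1, fun σ => ?_⟩
      simp [hent]
    | algebraMap x =>
      refine ⟨MvPolynomial.C (algebraMap K L x), 1, fun σ => ?_⟩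
      simp [σ.2.2 _ ⟨x, rfl⟩]
    | add x y _ _ hx hy =>
      obtain ⟨p, q, h⟩ := hx
      obtain ⟨p', q', h'⟩ := hy
      refine ⟨p * q' + p' * q, q * q', fun σ => ?_⟩
      obtain ⟨h1, h2⟩ := h σ
      obtain ⟨h3, h4⟩ := h' σ
      refine ⟨by simp [h1, h3], ?_⟩
      simp only [map_add, map_mul, ← h2, ← h4]
      ring
    | inv x _ hx =>
      obtain ⟨p, q, h⟩ := hx
      by_cases hx0 : x = 0
      · exact ⟨0, 1, fun σ => by simp [hx0]⟩
      · refine ⟨q, p, fun σ => ?_⟩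
        obtain ⟨h1, h2⟩ := h σ
        have h3 : σ.1 x ≠ 0 := by simpa using hx0
        rw [← h2, map_inv₀]
        exact ⟨mul_ne_zero h3 h1, by field_simp⟩
    | mul x y _ _ hx hy =>
      obtain ⟨p, q, h⟩ := hx
      obtain ⟨p', q', h'⟩ := hy
      refine ⟨p * p', q * q', fun σ => ?_⟩
      obtain ⟨h1, h2⟩ := h σ
      obtain ⟨h3, h4⟩ := h' σ
      refine ⟨by simp [h1, h3], ?_⟩
      simp only [map_mul, ← h2, ← h4]
      ring
  have hpoly : ∀ (m : ℕ) (a : Fin m → L) (P : MvPolynomial (Fin m) L),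
      ∃ p q : MvPolynomial (Fin n × Fin n) L, ∀ σ : DGal DL (algebraMap K L).fieldRange,
      MvPolynomial.eval (fun t => algebraMap ℂ L (ρ σ t)) q ≠ 0 ∧
      MvPolynomial.eval (fun i => σ.1 (a i)) P *
        MvPolynomial.eval (fun t => algebraMap ℂ L (ρ σ t)) q =
        MvPolynomial.eval (fun t => algebraMap ℂ L (ρ σ t)) p := by
    intro m a P
    induction P using MvPolynomial.induction_on with
    | C c => exact ⟨MvPolynomial.C c, 1, fun σ => by simp⟩
    | add P Q hP hQ =>
      obtain ⟨p, q, h⟩ := hP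
      obtain ⟨p', q', h'⟩ := hQ
      refine ⟨p * q' + p' * q, q * q', fun σ => ?_⟩
      obtain ⟨h1, h2⟩ := h σ
      obtain ⟨h3, h4⟩ := h' σ
      refine ⟨by simp [h1, h3], ?_⟩
      simp only [map_add, map_mul, ← h2, ← h4]
      ring
    | mul_X P i hP =>
      obtain ⟨p, q, h⟩ := hP
      obtain ⟨p', q', h'⟩ := hrat (a i)
      refine ⟨p * p', q * q', fun σ => ?_⟩
      obtain ⟨h1, h2⟩ := h σ
      obtain ⟨h3, h4⟩ := h' σ
      refine ⟨by simp [h1, h3], ?_⟩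
      simp only [map_mul, ← h2, ← h4, MvPolynomial.eval_X]
      ring
  apply le_antisymm
  · -- polynomial conditions on the matrix entries are polynomial conditions on `σ(Y)`
    rw [zariskiAffine, induced_generateFrom_eq (f := ρ)]
    refine le_generateFrom ?_
    rintro _ ⟨_, ⟨P, rfl⟩, rfl⟩
    let w := Fintype.equivFin (Fin n × Fin n)
    let Q : MvPolynomial (Fin (Fintype.card (Fin n × Fin n))) L :=
      MvPolynomial.bind₁ (fun t : Fin n × Fin n =>
        ∑ k, MvPolynomial.C (Y⁻¹ t.1 k) * MvPolynomial.X (w (k, t.2)))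
        (P.map (algebraMap ℂ L))
    refine ⟨{σ | MvPolynomial.eval (fun i => σ (Y (w.symm i).1 (w.symm i).2)) Q ≠ 0},
      TopologicalSpace.isOpen_generateFrom_of_mem
        ⟨_, fun i => Y (w.symm i).1 (w.symm i).2, Q, rfl⟩, ?_⟩
    ext σ
    have hQ : MvPolynomial.eval (fun i => σ.1 (Y (w.symm i).1 (w.symm i).2)) Q =
        algebraMap ℂ L (MvPolynomial.eval (ρ σ) P) := by
      have h5 : ∀ t : Fin n × Fin n,
          ∑ k, Y⁻¹ t.1 k * σ.1 (Y k t.2) = algebraMap ℂ L (ρ σ t) := by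
        intro t
        have := congrArg (fun Z => Y⁻¹ * Z) (hρ σ)
        simp only [Matrix.nonsing_inv_mul_cancel_left _ _ hu] at this
        simpa [Matrix.mul_apply] using congrFun (congrFun this t.1) t.2
      have h6 : MvPolynomial.eval (fun i => σ.1 (Y (w.symm i).1 (w.symm i).2)) Q =
          MvPolynomial.eval (fun t => algebraMap ℂ L (ρ σ t)) (P.map (algebraMap ℂ L)) := by
        simp only [Q]
        rw [← MvPolynomial.coe_aeval_eq_eval, RingHom.coe_coe, MvPolynomial.aeval_bind₁,
          ← MvPolynomial.coe_aeval_eq_eval, RingHom.coe_coe]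
        congr 2
        funext t
        simp [h5 t]
      rw [h6, MvPolynomial.eval_map]
      exact (MvPolynomial.eval₂_comp_left (algebraMap ℂ L) (RingHom.id ℂ) (ρ σ) P).symm
    simp only [Set.mem_preimage, Set.mem_ofPred_eq, hQ, ne_eq, map_eq_zero]
  · rw [zariskiAut, induced_generateFrom_eq
      (f := (Subtype.val : DGal DL (algebraMap K L).fieldRange → RingAut L))]
    refine le_generateFrom ?_
    rintro _ ⟨_, ⟨m, a, P, rfl⟩, rfl⟩
    obtain ⟨p, q, h⟩ := hpoly m a P
    let b := Module.Basis.ofVectorSpace ℂ L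
    let R : Module.Basis.ofVectorSpaceIndex ℂ L → MvPolynomial (Fin n × Fin n) ℂ := fun i =>
      ∑ d ∈ p.support, MvPolynomial.monomial d (b.repr (MvPolynomial.coeff d p) i)
    refine ⟨⋃ i, {x | MvPolynomial.eval x (R i) ≠ 0}, @isOpen_iUnion _ _ (zariskiAffine _ ℂ) _ fun i =>
      TopologicalSpace.isOpen_generateFrom_of_mem ⟨R i, rfl⟩, ?_⟩
    ext σ
    have h7 : ∀ i, MvPolynomial.eval (ρ σ) (R i) =
        b.repr (MvPolynomial.eval (fun t => algebraMap ℂ L (ρ σ t)) p) i := by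
      intro i
      rw [MvPolynomial.eval_eq (fun t => algebraMap ℂ L (ρ σ t)) p]
      simp only [R, map_sum, MvPolynomial.eval_monomial, Finsupp.coe_finsetSum,
        Finset.sum_apply]
      refine Finset.sum_congr rfl fun d _ => ?_
      have : MvPolynomial.coeff d p * ∏ i ∈ d.support, algebraMap ℂ L (ρ σ i) ^ d i =
          (∏ i ∈ d.support, ρ σ i ^ d i) • MvPolynomial.coeff d p := by
        rw [Algebra.smul_def, mul_comm]
        simp
      rw [this, map_smul]
      simp [mul_comm, Finsupp.prod]
    obtain ⟨h1, h2⟩ := h σ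
    simp only [Set.mem_preimage, Set.mem_iUnion, Set.mem_ofPred_eq]
    rw [← not_iff_not]
    push Not
    have h8 : MvPolynomial.eval (fun i => σ.1 (a i)) P = 0 ↔
        MvPolynomial.eval (fun t => algebraMap ℂ L (ρ σ t)) p = 0 := by
      rw [← h2]
      simp [h1]
    rw [h8, ← b.repr.map_eq_zero_iff, Finsupp.ext_iff]
    simp only [h7, Finsupp.coe_zero, Pi.zero_apply]

/-! ## Eigenrings -/

/-- The eigenring of the system `∂ Y = -A Y` over `(K, ∂)`: the `ℂ`-algebra of the
matrices `P` over `K` with `∂ P = P A - A P`. -/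
def eigenring {K : Type*} [Field K] [Algebra ℂ K] {n : ℕ} (D : Derivation ℂ K K)
    (A : Matrix (Fin n) (Fin n) K) : Subalgebra ℂ (Matrix (Fin n) (Fin n) K) where
  carrier := {P | P.map D = P * A - A * P}
  mul_mem' := by
    intro P Q hP hQ
    simp only [Set.mem_ofPred_eq] at hP hQ ⊢
    have h : (P * Q).map D = P.map D * Q + P * Q.map D := by
      ext i j
      simp only [Matrix.map_apply, Matrix.mul_apply, Matrix.add_apply, map_sum,
        Derivation.leibniz, smul_eq_mul, Finset.sum_add_distrib]
      rw [add_comm]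
      congr 1
      exact Finset.sum_congr rfl fun k _ => mul_comm _ _
    rw [h, hP, hQ]
    noncomm_ring
  add_mem' := by
    intro P Q hP hQ
    simp only [Set.mem_ofPred_eq] at hP hQ ⊢
    have h : (P + Q).map D = P.map D + Q.map D := by
      ext i j
      simp
    rw [h, hP, hQ]
    noncomm_ring
  algebraMap_mem' := by
    intro c
    simp only [Set.mem_ofPred_eq]
    rw [Algebra.commutes, sub_self]
    ext i j
    rw [Matrix.map_apply, Matrix.algebraMap_matrix_apply]
    split_ifs <;> simp

/-!
Since `∂ z ≠ 0`, the element `z` is transcendental over `ℂ`, so `f ↦ f(z)` embeds `ℂ(z)` into `K`.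
Over `ℂ(z)` the fields `K` and `Khat` are generated by `∂ z` and `s`, two square roots of `α`. These
have the same minimal polynomial: either it has degree one and `hbranch` identifies the roots, or
it is `X² - α` for both. This gives `φ` (`exists_algEquiv_of_sq_eq`). It is differential because two
derivations that agree on `z` agree on `α(z) = (∂ z)²`, hence on `∂ z`
(`exists_differential_algEquiv`).

Through `φ`, both `L` and `Lhat` are Picard-Vessiot extensions of `K` for the same system, and `Φ`
is the uniqueness of such extensions (`IsPicardVessiot.exists_algEquiv`). Its proof uses no
maximal differential ideals. Let `Y₁`, `Y₂` be fundamental matrices in extensions `L₁`, `L₂`. In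
`L₁ ⊗[K] L₂` the entries of `Z = Y₁⁻¹ Y₂` are constants, and constants of a differential
`L₁`-algebra that satisfy a linear relation over `L₁` satisfy it as a consequence of relations over
`ℂ` (`derivation_linear_relations`). The Nullstellensatz specializes `Z` to an invertible complex
matrix `c` that respects all polynomial relations over `ℂ`, so every polynomial relation over `K`
satisfied by `Y₂` is satisfied by `Y₁ c` (`exists_matrix_relations`). Doing this in both directions
gives `I ⊆ I₁ ⊆ θ⁻¹ I` for the ideals `I` and `I₁` of relations of `Y₂` and `Y₁ c`, with `θ` an
automorphism of a noetherian ring. Hence the ideals coincide, and `L₁ ≃ L₂` as fraction fields of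
the same quotient.

Conjugation by `Φ` is then an isomorphism of the differential Galois groups and a homeomorphism for
the Zariski topologies. The group `G` over `Khat` is the stabilizer of `s` in the group `H` over
`ℂ(z)`, and elements of `H` send `s` to `s` or `-s`. So `G` is open and closed in `H`, and the two
groups have the same identity component (`identityComponent_DGal_eq`).
-/

/-! ### Constants and linear relations -/

/-- Constants of a differential vector space over a field `L` with constants `ℂ`: their linear
relations over `L` follow from those over `ℂ`. This is expressed by saying that a second family
`e'` satisfying all `ℂ`-relations of the family of constants `e` satisfies all its `L`-relations.
The proof is by induction on the support: a relation normalized to have a coefficient `1` becomes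
shorter when it is differentiated. -/
theorem derivation_linear_relations {L M M' ι : Type*} [Field L] [Algebra ℂ L]
    (DL : Derivation ℂ L L) (hconst : ∀ y : L, DL y = 0 → y ∈ (algebraMap ℂ L).range)
    [AddCommGroup M] [Module L M] [AddCommGroup M'] [Module L M']
    (DM : M →+ M) (hDM : ∀ (l : L) (m : M), DM (l • m) = DL l • m + l • DM m)
    (e : ι → M) (he : ∀ i, DM (e i) = 0) (e' : ι → M')
    (h : ∀ (s : Finset ι) (r : ι → ℂ), ∑ i ∈ s, algebraMap ℂ L (r i) • e i = 0 →
      ∑ i ∈ s, algebraMap ℂ L (r i) • e' i = 0)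
    (s : Finset ι) (q : ι → L) (hq : ∑ i ∈ s, q i • e i = 0) : ∑ i ∈ s, q i • e' i = 0 := by
  classical
  induction s using Finset.strongInduction generalizing q with
  | H s ih =>
  have hzero : ∀ p : ι → L, ∑ i ∈ s, p i • e i = 0 → (∃ i ∈ s, p i = 0) →
      ∑ i ∈ s, p i • e' i = 0 := by
    rintro p hp ⟨i, hi, hpi⟩
    rw [← Finset.add_sum_erase s _ hi, hpi, zero_smul, zero_add] at hp ⊢
    exact ih _ (Finset.erase_ssubset hi) p hp
  have hder : ∀ p : ι → L, ∑ i ∈ s, p i • e i = 0 → ∑ i ∈ s, DL (p i) • e i = 0 := by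
    intro p hp
    simpa [map_sum, hDM, he] using congrArg DM hp
  by_cases h0 : ∃ i ∈ s, q i = 0
  · exact hzero q hq h0
  push Not at h0
  rcases s.eq_empty_or_nonempty with rfl | ⟨m, hm⟩
  · simp
  -- normalize the relation to have coefficient `1` at `m`
  set p : ι → L := fun i => (q m)⁻¹ * q i with hpdef
  have hp : ∑ i ∈ s, p i • e i = 0 := by
    simp only [hpdef, mul_smul, ← Finset.smul_sum, hq, smul_zero]
  have hpm : p m = 1 := inv_mul_cancel₀ (h0 m hm)
  suffices hgoal : ∑ i ∈ s, p i • e' i = 0 by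
    simp only [hpdef, mul_smul, ← Finset.smul_sum] at hgoal
    exact (smul_eq_zero.1 hgoal).resolve_left (inv_ne_zero (h0 m hm))
  have hp' : ∑ i ∈ s, DL (p i) • e' i = 0 :=
    hzero (fun i => DL (p i)) (hder p hp) ⟨m, hm, by simp [hpm]⟩
  by_cases hc : ∀ i ∈ s, DL (p i) = 0
  · have hex : ∀ i, ∃ c : ℂ, i ∈ s → algebraMap ℂ L c = p i := fun i => by
      by_cases hi : i ∈ s
      · obtain ⟨c, hc'⟩ := hconst _ (hc i hi)
        exact ⟨c, fun _ => hc'⟩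
      · exact ⟨0, fun h => absurd h hi⟩
    choose r hr using hex
    have hrel := h s r (by
      rw [← hp]
      exact Finset.sum_congr rfl fun i hi => by rw [hr i hi])
    rw [← hrel]
    exact Finset.sum_congr rfl fun i hi => by rw [hr i hi]
  · push Not at hc
    obtain ⟨i, hi, hDi⟩ := hc
    have hpi : p i ≠ 0 := fun h => hDi (by simp [h])
    -- normalizing at `i` instead multiplies the relation by the non-constant `(p i)⁻¹`
    have hu : ∑ j ∈ s, DL ((p i)⁻¹ * p j) • e' j = 0 := by
      refine hzero (fun j => DL ((p i)⁻¹ * p j)) (hder (fun j => (p i)⁻¹ * p j) ?_)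
        ⟨i, hi, by simp [hpi]⟩
      simp only [mul_smul, ← Finset.smul_sum, hp, smul_zero]
    simp only [Derivation.leibniz, smul_eq_mul, add_smul, Finset.sum_add_distrib, mul_smul,
      ← Finset.smul_sum, hp', smul_zero, zero_add] at hu
    have hu' : DL (p i)⁻¹ • ∑ j ∈ s, p j • e' j = 0 := by
      rw [← hu, Finset.smul_sum]
      exact Finset.sum_congr rfl fun j _ => by rw [← mul_smul, ← mul_smul, mul_comm]
    refine (smul_eq_zero.1 hu').resolve_left ?_
    rw [Derivation.leibniz_inv]
    simp [hpi, hDi]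

open scoped TensorProduct in
/-- The derivation `D₁ ⊗ 1 + 1 ⊗ D₂` of the tensor product of two differential extensions. The two
summands are not separately defined, as `D₁` and `D₂` are not `K`-linear. -/
theorem exists_tensor_derivation {K L₁ L₂ : Type*} [Field K] [Algebra ℂ K] [Field L₁]
    [Algebra ℂ L₁] [Algebra K L₁] [Field L₂] [Algebra ℂ L₂] [Algebra K L₂]
    (DK : Derivation ℂ K K) (D₁ : Derivation ℂ L₁ L₁) (D₂ : Derivation ℂ L₂ L₂)
    (h₁ : ∀ a : K, D₁ (algebraMap K L₁ a) = algebraMap K L₁ (DK a))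
    (h₂ : ∀ a : K, D₂ (algebraMap K L₂ a) = algebraMap K L₂ (DK a)) :
    ∃ DM : (L₁ ⊗[K] L₂) →+ (L₁ ⊗[K] L₂),
      (∀ x y, DM (x ⊗ₜ y) = D₁ x ⊗ₜ y + x ⊗ₜ D₂ y) ∧
      ∀ x y, DM (x * y) = DM x * y + x * DM y := by
  let f : L₁ →+ L₂ →+ L₁ ⊗[K] L₂ :=
    AddMonoidHom.mk' (fun x => AddMonoidHom.mk' (fun y => D₁ x ⊗ₜ y + x ⊗ₜ D₂ y) (by
      intro a b; simp only [TensorProduct.tmul_add, map_add]; abel)) (by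
      intro a b; ext y
      simp only [TensorProduct.add_tmul, map_add, AddMonoidHom.mk'_apply, AddMonoidHom.add_apply]
      abel)
  have hf : ∀ (r : K) (x : L₁) (y : L₂), f (r • x) y = f x (r • y) := by
    intro r x y
    change D₁ (r • x) ⊗ₜ y + (r • x) ⊗ₜ D₂ y = D₁ x ⊗ₜ (r • y) + x ⊗ₜ D₂ (r • y)
    have e₁ : D₁ (r • x) = DK r • x + r • D₁ x := by
      rw [Algebra.smul_def, Derivation.leibniz, h₁, smul_eq_mul, smul_eq_mul, Algebra.smul_def,
        Algebra.smul_def]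
      ring
    have e₂ : D₂ (r • y) = DK r • y + r • D₂ y := by
      rw [Algebra.smul_def, Derivation.leibniz, h₂, smul_eq_mul, smul_eq_mul, Algebra.smul_def,
        Algebra.smul_def]
      ring
    rw [e₁, e₂]
    simp only [TensorProduct.add_tmul, TensorProduct.tmul_add, TensorProduct.tmul_smul,
      TensorProduct.smul_tmul']
    abel
  have hT : ∀ x y, TensorProduct.liftAddHom f hf (x ⊗ₜ y) = D₁ x ⊗ₜ y + x ⊗ₜ D₂ y :=
    fun x y => rfl
  refine ⟨TensorProduct.liftAddHom f hf, hT, fun x y => ?_⟩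
  induction x using TensorProduct.induction_on with
  | zero => simp
  | add x x' hx hx' => rw [add_mul, map_add, hx, hx', map_add]; ring
  | tmul a b =>
    induction y using TensorProduct.induction_on with
    | zero => simp
    | add y y' hy hy' => rw [mul_add, map_add, hy, hy', map_add]; ring
    | tmul c d =>
      simp only [Algebra.TensorProduct.tmul_mul_tmul, hT, Derivation.leibniz, smul_eq_mul,
        add_mul, mul_add, TensorProduct.add_tmul, TensorProduct.tmul_add]
      rw [mul_comm c, mul_comm d]
      abel

/-- Given fundamental matrices `Y₁`, `Y₂` of the same system in two Picard-Vessiot extensions, some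
invertible complex matrix `c` makes `Y₁ c` satisfy all polynomial relations over `K` of `Y₂`. -/
theorem exists_matrix_relations {K L₁ L₂ : Type*} [Field K] [Algebra ℂ K] [Field L₁]
    [Algebra ℂ L₁] [Algebra K L₁]
    [Field L₂] [Algebra ℂ L₂] [Algebra K L₂] {n : ℕ}
    {DK : Derivation ℂ K K} {A : Matrix (Fin n) (Fin n) K}
    {D₁ : Derivation ℂ L₁ L₁} {D₂ : Derivation ℂ L₂ L₂}
    (h₁ : IsPicardVessiot DK A D₁) (h₂ : IsPicardVessiot DK A D₂)
    {Y₁ : Matrix (Fin n) (Fin n) L₁} (hY₁ : IsFundamentalMatrix A D₁ Y₁)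
    {Y₂ : Matrix (Fin n) (Fin n) L₂} (hY₂ : IsFundamentalMatrix A D₂ Y₂) :
    ∃ c : Matrix (Fin n) (Fin n) ℂ, c.det ≠ 0 ∧
      ∀ p : MvPolynomial (Fin n × Fin n) K,
        MvPolynomial.aeval (fun t : Fin n × Fin n => Y₂ t.1 t.2) p = 0 →
        MvPolynomial.aeval
          (fun t : Fin n × Fin n => (Y₁ * c.map (algebraMap ℂ L₁)) t.1 t.2) p = 0 := by
  classical
  obtain ⟨DM, hDM, hmul⟩ := exists_tensor_derivation DK D₁ D₂ h₁.deriv_algebraMap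
    h₂.deriv_algebraMap
  obtain ⟨hdet₁, hD₁⟩ := hY₁
  obtain ⟨hdet₂, hD₂⟩ := hY₂
  let i₁ : L₁ →ₐ[K] TensorProduct K L₁ L₂ := Algebra.TensorProduct.includeLeft
  let i₂ : L₂ →ₐ[K] TensorProduct K L₁ L₂ := Algebra.TensorProduct.includeRight
  have hi₁ : ∀ x, DM (i₁ x) = i₁ (D₁ x) := fun x => by
    change DM (x ⊗ₜ 1) = D₁ x ⊗ₜ 1
    rw [hDM]; simp
  have hi₂ : ∀ x, DM (i₂ x) = i₂ (D₂ x) := fun x => by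
    change DM (1 ⊗ₜ x) = 1 ⊗ₜ D₂ x
    rw [hDM]; simp
  have halg : ∀ x, algebraMap L₁ (TensorProduct K L₁ L₂) x = i₁ x := fun x => rfl
  -- the matrix `Z = Y₁⁻¹ Y₂` over the tensor product consists of constants
  set Z : Matrix (Fin n) (Fin n) (TensorProduct K L₁ L₂) := Y₁⁻¹.map i₁ * Y₂.map i₂ with hZ
  have hY₁u : Y₁⁻¹.map i₁ * Y₁.map i₁ = 1 := by
    rw [← Matrix.map_mul, Matrix.nonsing_inv_mul _ (isUnit_iff_ne_zero.2 hdet₁)]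
    simp
  have hY₁u' : Y₁.map i₁ * Y₁⁻¹.map i₁ = 1 := by
    rw [← Matrix.map_mul, Matrix.mul_nonsing_inv _ (isUnit_iff_ne_zero.2 hdet₁)]
    simp
  have hYZ : Y₁.map i₁ * Z = Y₂.map i₂ := by
    rw [hZ, ← Matrix.mul_assoc, hY₁u', Matrix.one_mul]
  have hprod : ∀ P Q : Matrix (Fin n) (Fin n) (TensorProduct K L₁ L₂),
      (P * Q).map DM = P.map DM * Q + P * Q.map DM := by
    intro P Q
    ext i j
    simp only [Matrix.map_apply, Matrix.mul_apply, Matrix.add_apply, map_sum, hmul,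
      Finset.sum_add_distrib]
  have hder₁ : (Y₁.map i₁).map DM =
      -(A.map (algebraMap K (TensorProduct K L₁ L₂))) * Y₁.map i₁ := by
    ext i j
    have := congrArg i₁ (congrFun (congrFun hD₁ i) j)
    simpa [Matrix.mul_apply, hi₁] using this
  have hder₂ : (Y₂.map i₂).map DM =
      -(A.map (algebraMap K (TensorProduct K L₁ L₂))) * Y₂.map i₂ := by
    ext i j
    have := congrArg i₂ (congrFun (congrFun hD₂ i) j)
    simpa [Matrix.mul_apply, hi₂] using this
  have hDZ : ∀ i j, DM (Z i j) = 0 := by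
    have h := hprod (Y₁.map i₁) Z
    rw [hYZ, hder₁, hder₂, Matrix.mul_assoc, hYZ] at h
    have h' : Z.map DM = 0 := by
      rw [← Matrix.one_mul (Z.map DM), ← hY₁u, Matrix.mul_assoc, left_eq_add.1 h,
        Matrix.mul_zero]
    exact fun i j => congrFun (congrFun h' i) j
  let zf : Fin n × Fin n → TensorProduct K L₁ L₂ := fun t => Z t.1 t.2
  have hmon : ∀ d : Fin n × Fin n →₀ ℕ, DM (∏ t, zf t ^ d t) = 0 := by
    have hone : DM 1 = 0 := by
      have := hmul 1 1
      simpa using this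
    have hpow : ∀ (x) (k : ℕ), DM x = 0 → DM (x ^ k) = 0 := by
      intro x k hx
      induction k with
      | zero => simpa using hone
      | succ k ih => rw [pow_succ, hmul, ih, hx]; simp
    intro d
    refine Finset.prod_induction _ (fun x => DM x = 0) ?_ hone fun t _ => hpow _ _ (hDZ _ _)
    intro a b ha hb
    rw [hmul, ha, hb]; simp
  -- the Nullstellensatz specializes `Z` to an invertible matrix over `ℂ`
  let ev : MvPolynomial (Fin n × Fin n) ℂ →+* TensorProduct K L₁ L₂ :=
    MvPolynomial.eval₂Hom (i₁.toRingHom.comp (algebraMap ℂ L₁)) zf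
  let X : Matrix (Fin n) (Fin n) (MvPolynomial (Fin n × Fin n) ℂ) :=
    Matrix.of fun i j => MvPolynomial.X (i, j)
  obtain ⟨c, hc, hcdet⟩ : ∃ c : Fin n × Fin n → ℂ,
      (∀ r ∈ RingHom.ker ev, MvPolynomial.aeval c r = 0) ∧ MvPolynomial.aeval c X.det ≠ 0 := by
    by_contra! hcon
    have hmem : X.det ∈ MvPolynomial.vanishingIdeal ℂ
        (MvPolynomial.zeroLocus ℂ (RingHom.ker ev)) := fun c hc => hcon c hc
    rw [MvPolynomial.vanishingIdeal_zeroLocus_eq_radical] at hmem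
    obtain ⟨N, hN⟩ := hmem
    rw [RingHom.mem_ker, map_pow, RingHom.map_det] at hN
    have hXZ : ev.mapMatrix X = Z := by
      ext i j
      simp [X, ev, zf]
    have hZu : IsUnit Z.det := by
      have hu₁ : IsUnit (Y₁⁻¹.map i₁).det :=
        (Matrix.isUnit_iff_isUnit_det _).1 (IsUnit.of_mul_eq_one _ hY₁u)
      have hu₂ : IsUnit (Y₂.map i₂).det := by
        have := (isUnit_iff_ne_zero.2 hdet₂).map i₂
        rwa [AlgHom.map_det] at this
      rw [hZ, Matrix.det_mul]
      exact hu₁.mul hu₂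
    rw [hXZ] at hN
    exact (hZu.pow N).ne_zero hN
  refine ⟨Matrix.of fun i j => c (i, j), ?_, fun p hp => ?_⟩
  · convert hcdet
    rw [AlgHom.map_det]
    congr 1
    ext i j
    simp [X]
  -- substitute `Y₁ Z` for `Y₂` and compare coefficients
  let q : MvPolynomial (Fin n × Fin n) L₁ := MvPolynomial.aeval
    (fun t : Fin n × Fin n => ∑ k, MvPolynomial.C (Y₁ t.1 k) * MvPolynomial.X (k, t.2)) p
  have hqM : MvPolynomial.aeval zf q = 0 := by
    have : MvPolynomial.aeval zf q = i₂ (MvPolynomial.aeval (fun t => Y₂ t.1 t.2) p) := by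
      have e : ((MvPolynomial.aeval (R := L₁) zf).restrictScalars K).comp (MvPolynomial.aeval
          (fun t : Fin n × Fin n => ∑ k, MvPolynomial.C (Y₁ t.1 k) * MvPolynomial.X (k, t.2))) =
          i₂.comp (MvPolynomial.aeval (fun t : Fin n × Fin n => Y₂ t.1 t.2)) := by
        ext t
        have := congrFun (congrFun hYZ t.1) t.2
        simpa [Matrix.mul_apply, halg, zf] using this
      exact congrArg (fun g => g p) e
    rw [this, hp, map_zero]
  have hqc : MvPolynomial.aeval (fun t => algebraMap ℂ L₁ (c t)) q = MvPolynomial.aeval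
      (fun t : Fin n × Fin n =>
        (Y₁ * (Matrix.of fun i j => c (i, j)).map (algebraMap ℂ L₁)) t.1 t.2) p := by
    have e : ((MvPolynomial.aeval (R := L₁) fun t => algebraMap ℂ L₁ (c t)).restrictScalars K).comp
        (MvPolynomial.aeval
          (fun t : Fin n × Fin n => ∑ k, MvPolynomial.C (Y₁ t.1 k) * MvPolynomial.X (k, t.2))) =
        MvPolynomial.aeval (fun t : Fin n × Fin n =>
          (Y₁ * (Matrix.of fun i j => c (i, j)).map (algebraMap ℂ L₁)) t.1 t.2) := by
      ext t
      simp [Matrix.mul_apply]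
    exact congrArg (fun g => g p) e
  rw [← hqc]
  rw [MvPolynomial.aeval_def, MvPolynomial.eval₂_eq'] at hqM ⊢
  refine derivation_linear_relations D₁ h₁.constants DM (fun l m => ?_)
    (fun d : Fin n × Fin n →₀ ℕ => ∏ t, zf t ^ d t) hmon
    (fun d : Fin n × Fin n →₀ ℕ => ∏ t, algebraMap ℂ L₁ (c t) ^ d t) (fun s r hr => ?_)
    q.support (fun d => q.coeff d) ?_
  · rw [Algebra.smul_def, Algebra.smul_def, Algebra.smul_def, halg, halg, hmul, hi₁]
  · have hker : (∑ d ∈ s, MvPolynomial.monomial d (r d)) ∈ RingHom.ker ev := by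
      rw [RingHom.mem_ker, map_sum, ← hr]
      refine Finset.sum_congr rfl fun d _ => ?_
      simp [ev, Algebra.smul_def, halg, Finsupp.prod_fintype]
    have := congrArg (algebraMap ℂ L₁) (hc _ hker)
    rw [map_sum, map_sum, map_zero] at this
    rw [← this]
    refine Finset.sum_congr rfl fun d _ => ?_
    simp [MvPolynomial.aeval_monomial, Finsupp.prod_fintype]
  · simpa only [Algebra.smul_def] using hqM

/-! ### Uniqueness of Picard-Vessiot extensions -/

/-- The preimages of `I` under the powers of `θ` form an ascending chain, which stabilizes. -/
theorem Ideal.comap_eq_of_le_of_surjective {R : Type*} [CommRing R] [IsNoetherianRing R]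
    (θ : R →+* R) (hθ : Function.Surjective θ) (I : Ideal R) (h : I ≤ I.comap θ) :
    I.comap θ = I := by
  have hmono : Monotone fun k : ℕ => (Ideal.comap θ)^[k] I := by
    refine monotone_nat_of_le_succ fun k => ?_
    rw [Function.iterate_succ_apply]
    exact (Monotone.iterate (fun _ _ h => Ideal.comap_mono h) k) h
  obtain ⟨k, hk⟩ := monotone_stabilizes_iff_noetherian.2 ‹_› ⟨_, hmono⟩
  have hk' := hk (k + 1) (Nat.le_succ k)
  simp only [OrderHom.coe_mk, Function.iterate_succ_apply] at hk'
  exact ((Ideal.comap_injective_of_surjective θ hθ).iterate k hk').symm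

theorem IsFractionRing.of_adjoin_range_eq_top {K L τ : Type*} [Field K] [Field L] [Algebra K L]
    (y : τ → L) (hy : IntermediateField.adjoin K (Set.range y) = ⊤) :
    IsFractionRing (MvPolynomial.aeval (R := K) y).range L := by
  refine IsFractionRing.of_field _ _ fun x => ?_
  have hx : x ∈ IntermediateField.adjoin K (Set.range y) := hy ▸ IntermediateField.mem_top
  obtain ⟨r, hr, s, hs, rfl⟩ := IntermediateField.mem_adjoin_iff_div.1 hx
  rw [Algebra.adjoin_range_eq_range_aeval] at hr hs
  exact ⟨⟨r, hr⟩, ⟨s, hs⟩, rfl⟩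

theorem exists_algEquiv_of_ker_aeval_eq {K L₁ L₂ τ : Type*} [Field K] [Field L₁] [Algebra K L₁]
    [Field L₂] [Algebra K L₂] (y₁ : τ → L₁) (y₂ : τ → L₂)
    (h₁ : IntermediateField.adjoin K (Set.range y₁) = ⊤)
    (h₂ : IntermediateField.adjoin K (Set.range y₂) = ⊤)
    (hker : ∀ p : MvPolynomial τ K,
      MvPolynomial.aeval y₁ p = 0 ↔ MvPolynomial.aeval y₂ p = 0) :
    ∃ Φ : L₁ ≃ₐ[K] L₂, ∀ t, Φ (y₁ t) = y₂ t := by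
  let f₁ : MvPolynomial τ K →ₐ[K] L₁ := MvPolynomial.aeval y₁
  let f₂ : MvPolynomial τ K →ₐ[K] L₂ := MvPolynomial.aeval y₂
  have hI : RingHom.ker f₁.rangeRestrict = RingHom.ker f₂.rangeRestrict := by
    rw [AlgHom.ker_rangeRestrict, AlgHom.ker_rangeRestrict]
    ext p
    exact hker p
  let e : f₁.range ≃ₐ[K] f₂.range :=
    ((Ideal.quotientKerAlgEquivOfSurjective f₁.rangeRestrict_surjective).symm.trans
      (Ideal.quotientEquivAlgOfEq K hI)).trans
      (Ideal.quotientKerAlgEquivOfSurjective f₂.rangeRestrict_surjective)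
  have he : ∀ p, e (f₁.rangeRestrict p) = f₂.rangeRestrict p := fun p => by
    simp only [e, AlgEquiv.trans_apply, Ideal.quotientKerAlgEquivOfSurjective_symm_apply,
      Ideal.quotientEquivAlgOfEq_mk, Ideal.quotientKerAlgEquivOfSurjective_mk]
  have : IsFractionRing f₁.range L₁ := IsFractionRing.of_adjoin_range_eq_top y₁ h₁
  have : IsFractionRing f₂.range L₂ := IsFractionRing.of_adjoin_range_eq_top y₂ h₂
  let Φ : L₁ ≃+* L₂ := IsFractionRing.ringEquivOfRingEquiv e.toRingEquiv
  have hΦ : ∀ p, Φ (f₁ p) = f₂ p := fun p => by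
    have := IsFractionRing.ringEquivOfRingEquiv_algebraMap (K := L₁) (L := L₂) e.toRingEquiv
      (f₁.rangeRestrict p)
    exact this.trans (congrArg Subtype.val (he p))
  refine ⟨AlgEquiv.ofRingEquiv (f := Φ) fun a => ?_, fun t => ?_⟩
  · have := hΦ (MvPolynomial.C a)
    simpa [f₁, f₂] using this
  · have := hΦ (MvPolynomial.X t)
    simpa [f₁, f₂] using this

theorem map_derivation_of_mem_adjoin {F L M : Type*} [Field F] [Field L] [Algebra F L]
    [Algebra ℂ L] [Field M] [Algebra ℂ M] (f : L →+* M) (DL : Derivation ℂ L L)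
    (DM : Derivation ℂ M M) (S : Set L)
    (hF : ∀ a : F, f (DL (algebraMap F L a)) = DM (f (algebraMap F L a)))
    (hS : ∀ y ∈ S, f (DL y) = DM (f y)) {y : L} (hy : y ∈ IntermediateField.adjoin F S) :
    f (DL y) = DM (f y) := by
  induction hy using IntermediateField.adjoin_induction with
  | mem x hx => exact hS x hx
  | algebraMap x => exact hF x
  | add x y _ _ hx hy => simp only [map_add, hx, hy]
  | inv x _ hx => simp only [Derivation.leibniz_inv, map_inv₀, smul_eq_mul, map_mul, map_neg,
      map_pow, hx]
  | mul x y _ _ hx hy => simp only [Derivation.leibniz, smul_eq_mul, map_mul, map_add, hx, hy]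

theorem IsFundamentalMatrix.mul_const {K L : Type*} [Field K] [Field L] [Algebra ℂ L]
    [Algebra K L] {n : ℕ} {A : Matrix (Fin n) (Fin n) K} {DL : Derivation ℂ L L}
    {Y : Matrix (Fin n) (Fin n) L} (hY : IsFundamentalMatrix A DL Y)
    {c : Matrix (Fin n) (Fin n) ℂ} (hc : c.det ≠ 0) :
    IsFundamentalMatrix A DL (Y * c.map (algebraMap ℂ L)) := by
  refine ⟨?_, ?_⟩
  · rw [Matrix.det_mul]
    refine mul_ne_zero hY.1 ?_
    have := (algebraMap ℂ L).map_det c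
    rw [RingHom.mapMatrix_apply] at this
    rw [← this]
    simpa using hc
  · have h : (Y * c.map (algebraMap ℂ L)).map DL = Y.map DL * c.map (algebraMap ℂ L) := by
      ext i j
      simp [Matrix.mul_apply, mul_comm]
    rw [h, hY.2, Matrix.mul_assoc]

theorem adjoin_range_mul_const_eq_top {K L : Type*} [Field K] [Field L] [Algebra ℂ K]
    [Algebra ℂ L] [Algebra K L] [IsScalarTower ℂ K L] {n : ℕ} {Y : Matrix (Fin n) (Fin n) L}
    (hgen : IntermediateField.adjoin K (Set.range fun p : Fin n × Fin n => Y p.1 p.2) = ⊤)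
    {c : Matrix (Fin n) (Fin n) ℂ} (hc : c.det ≠ 0) :
    IntermediateField.adjoin K (Set.range fun p : Fin n × Fin n =>
      (Y * c.map (algebraMap ℂ L)) p.1 p.2) = ⊤ := by
  rw [eq_top_iff, ← hgen, IntermediateField.adjoin_le_iff]
  rintro _ ⟨⟨i, j⟩, rfl⟩
  have hinv : Y = Y * c.map (algebraMap ℂ L) * c⁻¹.map (algebraMap ℂ L) := by
    rw [Matrix.mul_assoc, ← Matrix.map_mul, Matrix.mul_nonsing_inv _ (isUnit_iff_ne_zero.2 hc)]
    simp
  suffices hmem : (Y * c.map (algebraMap ℂ L) * c⁻¹.map (algebraMap ℂ L)) i j ∈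
      IntermediateField.adjoin K (Set.range fun p : Fin n × Fin n =>
        (Y * c.map (algebraMap ℂ L)) p.1 p.2) by
    rwa [← hinv] at hmem
  rw [Matrix.mul_apply]
  refine sum_mem fun k _ => mul_mem (IntermediateField.subset_adjoin _ _ ⟨(i, k), rfl⟩) ?_
  rw [Matrix.map_apply, IsScalarTower.algebraMap_apply ℂ K L]
  exact IntermediateField.algebraMap_mem _ _

/-- Right multiplication by an invertible constant matrix `d` is an automorphism of the ring of
polynomials in the entries of a matrix. -/
theorem exists_surjective_aeval_mul_const {K L : Type*} [Field K] [Algebra ℂ K] [Field L]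
    [Algebra ℂ L] [Algebra K L] [IsScalarTower ℂ K L] {n : ℕ} (Y : Matrix (Fin n) (Fin n) L)
    {d : Matrix (Fin n) (Fin n) ℂ} (hd : d.det ≠ 0) :
    ∃ θ : MvPolynomial (Fin n × Fin n) K →+* MvPolynomial (Fin n × Fin n) K,
      Function.Surjective θ ∧
      ∀ p, MvPolynomial.aeval (fun t : Fin n × Fin n => Y t.1 t.2) (θ p) =
        MvPolynomial.aeval (fun t : Fin n × Fin n =>
          (Y * d.map (algebraMap ℂ L)) t.1 t.2) p := by
  let θ : Matrix (Fin n) (Fin n) ℂ → MvPolynomial (Fin n × Fin n) K →ₐ[K]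
      MvPolynomial (Fin n × Fin n) K := fun d => MvPolynomial.aeval fun t =>
    ∑ k, MvPolynomial.X (t.1, k) * MvPolynomial.C (algebraMap ℂ K (d k t.2))
  have hθ : Function.Surjective (θ d) := by
    have hcomp : (θ d).comp (θ d⁻¹) = AlgHom.id K _ := by
      ext t
      have hone : ∀ k, ∑ l, d k l * d⁻¹ l t.2 = (1 : Matrix (Fin n) (Fin n) ℂ) k t.2 := fun k => by
        rw [← Matrix.mul_nonsing_inv d (isUnit_iff_ne_zero.2 hd), Matrix.mul_apply]
      congr 1
      simp only [θ, AlgHom.comp_apply, MvPolynomial.aeval_X, map_sum, map_mul,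
        MvPolynomial.aeval_C, MvPolynomial.algebraMap_eq, AlgHom.id_apply, Finset.sum_mul]
      rw [Finset.sum_comm]
      simp only [mul_assoc, ← map_mul, ← Finset.mul_sum, ← map_sum, hone]
      simp [Matrix.one_apply]
    exact fun p => ⟨θ d⁻¹ p, congrArg (fun g => g p) hcomp⟩
  have hθY : ∀ p, MvPolynomial.aeval (fun t : Fin n × Fin n => Y t.1 t.2) (θ d p) =
      MvPolynomial.aeval (fun t : Fin n × Fin n =>
        (Y * d.map (algebraMap ℂ L)) t.1 t.2) p := by
    have e : (MvPolynomial.aeval (fun t : Fin n × Fin n => Y t.1 t.2)).comp (θ d) =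
        MvPolynomial.aeval (R := K) (fun t : Fin n × Fin n =>
          (Y * d.map (algebraMap ℂ L)) t.1 t.2) := by
      ext t
      simp [θ, Matrix.mul_apply, ← IsScalarTower.algebraMap_apply]
    exact fun p => congrArg (fun g => g p) e
  exact ⟨(θ d).toRingHom, hθ, hθY⟩

/-- Uniqueness of Picard-Vessiot extensions with field of constants `ℂ`. -/
theorem IsPicardVessiot.exists_algEquiv {K L₁ L₂ : Type*} [Field K] [Algebra ℂ K] [Field L₁]
    [Algebra ℂ L₁] [Algebra K L₁] [IsScalarTower ℂ K L₁]
    [Field L₂] [Algebra ℂ L₂] [Algebra K L₂] [IsScalarTower ℂ K L₂] {n : ℕ}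
    {DK : Derivation ℂ K K} {A : Matrix (Fin n) (Fin n) K}
    {D₁ : Derivation ℂ L₁ L₁} {D₂ : Derivation ℂ L₂ L₂}
    (h₁ : IsPicardVessiot DK A D₁) (h₂ : IsPicardVessiot DK A D₂) :
    ∃ Φ : L₁ ≃ₐ[K] L₂, ∀ y, Φ (D₁ y) = D₂ (Φ y) := by
  obtain ⟨Y₀, hY₀, hgen₀⟩ := h₁.fundamental
  obtain ⟨Y₂, hY₂, hgen₂⟩ := h₂.fundamental
  obtain ⟨c, hc, hrel⟩ := exists_matrix_relations h₁ h₂ hY₀ hY₂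
  set Y₁ := Y₀ * c.map (algebraMap ℂ L₁)
  have hY₁ : IsFundamentalMatrix A D₁ Y₁ := hY₀.mul_const hc
  have hgen₁ : IntermediateField.adjoin K (Set.range fun p : Fin n × Fin n => Y₁ p.1 p.2) = ⊤ :=
    adjoin_range_mul_const_eq_top hgen₀ hc
  clear_value Y₁
  obtain ⟨d, hd, hrel'⟩ := exists_matrix_relations h₂ h₁ hY₂ hY₁
  obtain ⟨θ, hθ, hθY⟩ := exists_surjective_aeval_mul_const (K := K) Y₂ hd
  have hker : ∀ p : MvPolynomial (Fin n × Fin n) K,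
      MvPolynomial.aeval (fun t : Fin n × Fin n => Y₁ t.1 t.2) p = 0 ↔
        MvPolynomial.aeval (fun t : Fin n × Fin n => Y₂ t.1 t.2) p = 0 := by
    set f := MvPolynomial.aeval (R := K) fun t : Fin n × Fin n => Y₂ t.1 t.2
    have hcomap : ∀ p, MvPolynomial.aeval (fun t : Fin n × Fin n => Y₁ t.1 t.2) p = 0 →
        p ∈ (RingHom.ker f).comap θ := fun p hp =>
      Ideal.mem_comap.2 (RingHom.mem_ker.2 ((hθY p).trans (hrel' p hp)))
    have hI : (RingHom.ker f).comap θ = RingHom.ker f :=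
      Ideal.comap_eq_of_le_of_surjective θ hθ _ fun p hp => hcomap p (hrel p hp)
    exact fun p => ⟨fun hp => RingHom.mem_ker.1 (hI.le (hcomap p hp)), hrel p⟩
  obtain ⟨Φ, hΦ⟩ := exists_algEquiv_of_ker_aeval_eq _ _ hgen₁ hgen₂ hker
  refine ⟨Φ, fun y => map_derivation_of_mem_adjoin (F := K) (Φ : L₁ →+* L₂) D₁ D₂ _
    (fun a => ?_) ?_ (hgen₁ ▸ IntermediateField.mem_top : y ∈ _)⟩
  · rw [h₁.deriv_algebraMap]
    simp [h₂.deriv_algebraMap]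
  · rintro _ ⟨⟨i, j⟩, rfl⟩
    have e₁ := congrFun (congrFun hY₁.2 i) j
    have e₂ := congrFun (congrFun hY₂.2 i) j
    have hΦ' : ∀ k, Φ (Y₁ k j) = Y₂ k j := fun k => hΦ (k, j)
    simp only [Matrix.map_apply, Matrix.neg_apply, Matrix.mul_apply] at e₁ e₂
    simp only [RingHom.coe_coe, hΦ', e₁, e₂, map_neg, map_sum, map_mul, AlgEquiv.commutes]

/-- A Picard-Vessiot extension of `K'` is one of `K`, along an isomorphism of differential fields
`φ : K ≃ K'`. -/
theorem IsPicardVessiot.of_ringEquiv {K K' L : Type*} [Field K] [Algebra ℂ K] [Field K']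
    [Algebra ℂ K'] [Field L] [Algebra ℂ L] [Algebra K L] [Algebra K' L] (φ : K ≃+* K')
    (hφ : ∀ a, algebraMap K L a = algebraMap K' L (φ a)) {D : Derivation ℂ K K}
    {D' : Derivation ℂ K' K'} (hD : ∀ a, φ (D a) = D' (φ a)) {n : ℕ}
    {A : Matrix (Fin n) (Fin n) K} {DL : Derivation ℂ L L}
    (h : IsPicardVessiot D' (A.map φ) DL) : IsPicardVessiot D A DL where
  deriv_algebraMap a := by rw [hφ, hφ, h.deriv_algebraMap, hD]
  constants := h.constants
  fundamental := by
    obtain ⟨Y, ⟨hdet, hDY⟩, hgen⟩ := h.fundamental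
    refine ⟨Y, ⟨hdet, ?_⟩, ?_⟩
    · rw [hDY, Matrix.map_map]
      congr 2
      ext i j
      simp [hφ]
    · rw [eq_top_iff]
      intro x _
      have hx : x ∈ IntermediateField.adjoin K'
        (Set.range fun p : Fin n × Fin n => Y p.1 p.2) := hgen ▸ IntermediateField.mem_top
      refine IntermediateField.adjoin_le_subfield (K := (IntermediateField.adjoin K
        (Set.range fun p : Fin n × Fin n => Y p.1 p.2)).toSubfield) K' _ ?_
        (IntermediateField.subset_adjoin K _) hx
      rintro _ ⟨a, rfl⟩
      have := IntermediateField.algebraMap_mem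
        (IntermediateField.adjoin K (Set.range fun p : Fin n × Fin n => Y p.1 p.2)) (φ.symm a)
      rwa [hφ, RingEquiv.apply_symm_apply] at this

/-! ### The differential fields generated by a square root -/

/-- Two fields generated over `F` by square roots of the same element are isomorphic, compatibly
with these roots; `h` is needed only when the first root lies in `F`. -/
theorem exists_algEquiv_of_sq_eq {F K K' : Type*} [Field F] [Field K] [Field K'] [Algebra F K]
    [Algebra F K'] {w : K} {s : K'} {a : F} (hw : w ^ 2 = algebraMap F K a)
    (hs : s ^ 2 = algebraMap F K' a) (hK : IntermediateField.adjoin F {w} = ⊤)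
    (hK' : IntermediateField.adjoin F {s} = ⊤)
    (h : ∀ b : F, w = algebraMap F K b → s = algebraMap F K' b) :
    ∃ φ : K ≃ₐ[F] K', φ w = s := by
  have hmonic : (Polynomial.X ^ 2 - Polynomial.C a).Monic :=
    Polynomial.monic_X_pow_sub_C a two_ne_zero
  have hdeg : (Polynomial.X ^ 2 - Polynomial.C a).natDegree = 2 :=
    Polynomial.natDegree_X_pow_sub_C
  have hroot : Polynomial.aeval w (Polynomial.X ^ 2 - Polynomial.C a) = 0 := by simp [hw]
  have hw_int : IsIntegral F w := ⟨_, hmonic, hroot⟩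
  have hs_int : IsIntegral F s := ⟨_, hmonic, by
    rw [← Polynomial.aeval_def]; simp [hs]⟩
  have hzero : Polynomial.aeval s (minpoly F w) = 0 := by
    by_cases hb : w ∈ (algebraMap F K).range
    · obtain ⟨b, rfl⟩ := hb
      simp [h b rfl, minpoly.eq_X_sub_C]
    · have h2 := (minpoly.two_le_natDegree_iff hw_int).2 hb
      have heq : minpoly F w = Polynomial.X ^ 2 - Polynomial.C a :=
        (Polynomial.eq_of_monic_of_dvd_of_natDegree_le (minpoly.monic hw_int) hmonic
          (minpoly.dvd F w hroot) (by rw [hdeg]; exact h2)).symm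
      rw [heq]; simp [hs]
  have hmin : minpoly F w = minpoly F s :=
    minpoly.eq_of_irreducible_of_monic (minpoly.irreducible hw_int) hzero (minpoly.monic hw_int)
  let eK := (IntermediateField.equivOfEq hK).trans IntermediateField.topEquiv
  let eK' := (IntermediateField.equivOfEq hK').trans IntermediateField.topEquiv
  let pb := (IntermediateField.adjoin.powerBasis hw_int).map eK
  let pb' := (IntermediateField.adjoin.powerBasis hs_int).map eK'
  have hg : pb.gen = w := by
    simp only [pb, PowerBasis.map_gen, IntermediateField.adjoin.powerBasis_gen]
    rfl
  have hg' : pb'.gen = s := by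
    simp only [pb', PowerBasis.map_gen, IntermediateField.adjoin.powerBasis_gen]
    rfl
  have hpb : minpoly F pb.gen = minpoly F pb'.gen := by rw [hg, hg', hmin]
  refine ⟨pb.equivOfMinpoly pb' hpb, ?_⟩
  calc pb.equivOfMinpoly pb' hpb w = pb.equivOfMinpoly pb' hpb pb.gen := congrArg _ hg.symm
    _ = s := (pb.equivOfMinpoly_gen pb' hpb).trans hg'

theorem Derivation.transcendental_of_ne_zero {K : Type*} [Field K] [Algebra ℂ K]
    (D : Derivation ℂ K K) {z : K} (hz : D z ≠ 0) : Transcendental ℂ z := by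
  intro halg
  have hint := halg.isIntegral
  obtain ⟨c, rfl⟩ := minpoly.mem_range_of_degree_eq_one ℂ z
    (IsAlgClosed.degree_eq_one_of_irreducible ℂ (minpoly.irreducible hint))
  exact hz (by simp)

theorem ratEval_mem_adjoin {K : Type*} [Field K] [Algebra ℂ K] (z : K) (f : RatFunc ℂ) :
    ratEval z f ∈ IntermediateField.adjoin ℂ {z} :=
  have hle := IntermediateField.algebra_adjoin_le_adjoin ℂ {z}
  div_mem (hle (Polynomial.aeval_mem_adjoin_singleton ℂ z))
    (hle (Polynomial.aeval_mem_adjoin_singleton ℂ z))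

theorem exists_algHom_eq_ratEval {K : Type*} [Field K] [Algebra ℂ K] {z : K}
    (hz : Transcendental ℂ z) : ∃ ι : RatFunc ℂ →ₐ[ℂ] K, ∀ f, ι f = ratEval z f := by
  have hinj : Function.Injective (Polynomial.aeval (R := ℂ) z) :=
    transcendental_iff_injective.1 hz
  exact ⟨RatFunc.liftAlgHom (Polynomial.aeval z)
    (nonZeroDivisors_le_comap_nonZeroDivisors_of_injective _ hinj),
    fun f => RatFunc.liftAlgHom_apply _ _ f⟩

theorem exists_differential_algEquiv {K : Type*} [Field K] [Algebra ℂ K] (D : Derivation ℂ K K)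
    {z : K} (hz : D z ≠ 0) (hK : IntermediateField.adjoin ℂ {z, D z} = ⊤)
    {α : RatFunc ℂ} (hα : D z ^ 2 = ratEval z α)
    {Khat : Type*} [Field Khat] [Algebra ℂ Khat] [Algebra (RatFunc ℂ) Khat]
    [IsScalarTower ℂ (RatFunc ℂ) Khat]
    {s : Khat} (hs : s ^ 2 = algebraMap (RatFunc ℂ) Khat α)
    (hKhat : IntermediateField.adjoin (RatFunc ℂ) {s} = ⊤)
    (dz : Derivation ℂ Khat Khat) (hdz : dz (algebraMap (RatFunc ℂ) Khat RatFunc.X) = 1)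
    (hbranch : ∀ β : RatFunc ℂ, D z = ratEval z β → s = algebraMap (RatFunc ℂ) Khat β) :
    ∃ φ : K ≃ₐ[ℂ] Khat, φ z = algebraMap (RatFunc ℂ) Khat RatFunc.X ∧ φ (D z) = s ∧
      ∀ a, φ (D a) = (s • dz) (φ a) := by
  obtain ⟨ι, hι⟩ := exists_algHom_eq_ratEval (D.transcendental_of_ne_zero hz)
  let _ : Algebra (RatFunc ℂ) K := ι.toRingHom.toAlgebra
  have hmap : ∀ f, algebraMap (RatFunc ℂ) K f = ratEval z f := hι
  have : IsScalarTower ℂ (RatFunc ℂ) K := IsScalarTower.of_algebraMap_eq fun c =>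
    (ι.commutes c).symm
  have hX : algebraMap (RatFunc ℂ) K RatFunc.X = z := by
    rw [hmap]; simp [ratEval]
  have hKw : IntermediateField.adjoin (RatFunc ℂ) {D z} = ⊤ := by
    have hle : IntermediateField.adjoin ℂ {z, D z} ≤
        (IntermediateField.adjoin (RatFunc ℂ) {D z}).restrictScalars ℂ := by
      rw [IntermediateField.adjoin_le_iff]
      rintro x (rfl | rfl)
      · have := (IntermediateField.adjoin (RatFunc ℂ) {D x}).algebraMap_mem RatFunc.X
        rwa [hX] at this
      · exact IntermediateField.mem_adjoin_simple_self (RatFunc ℂ) _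
    rw [hK] at hle
    exact eq_top_iff.2 fun x _ => hle IntermediateField.mem_top
  obtain ⟨φ', hφ'⟩ := exists_algEquiv_of_sq_eq (a := α) (by rw [hmap, hα]) hs hKw hKhat
    fun b hb => hbranch b (by rw [← hmap, hb])
  let φ : K ≃ₐ[ℂ] Khat := φ'.restrictScalars ℂ
  have hφz : φ z = algebraMap (RatFunc ℂ) Khat RatFunc.X := by
    rw [← hX]; exact φ'.commutes _
  have hφw : φ (D z) = s := hφ'
  have hconst : ∀ c : ℂ, (φ : K →+* Khat) (D (algebraMap ℂ K c)) =
      (s • dz) ((φ : K →+* Khat) (algebraMap ℂ K c)) := fun c => by simp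
  have hgz : ∀ y ∈ ({z} : Set K), (φ : K →+* Khat) (D y) = (s • dz) ((φ : K →+* Khat) y) := by
    rintro y rfl
    simp [hφz, hφw, hdz]
  refine ⟨φ, hφz, hφw, fun a => map_derivation_of_mem_adjoin (F := ℂ) (φ : K →+* Khat) D (s • dz)
    {z, D z} hconst ?_ (hK ▸ IntermediateField.mem_top : a ∈ _)⟩
  rintro y (rfl | rfl)
  · exact hgz _ rfl
  · -- differentiate `(∂ z)² = α(z)`
    have h := map_derivation_of_mem_adjoin (F := ℂ) (φ : K →+* Khat) D (s • dz) {z} hconst hgz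
      (ratEval_mem_adjoin z α)
    rw [← hα, sq, Derivation.leibniz, map_mul, Derivation.leibniz] at h
    simp only [smul_eq_mul, map_add, map_mul] at h
    have hne : 2 * (φ : K →+* Khat) (D z) ≠ 0 :=
      have : CharZero Khat := charZero_of_injective_algebraMap (algebraMap ℂ Khat).injective
      mul_ne_zero two_ne_zero (by simpa using hz)
    refine mul_left_cancel₀ hne ?_
    linear_combination h

/-! ### The Zariski topology and conjugation -/


/-- Conjugation by an isomorphism of fields, as an isomorphism of automorphism groups. -/
def RingAut.conjEquiv {L M : Type*} [Field L] [Field M] (Φ : L ≃+* M) : RingAut L ≃* RingAut M where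
  toFun σ := (Φ.symm.trans σ).trans Φ
  invFun τ := (Φ.trans τ).trans Φ.symm
  left_inv σ := by ext; simp
  right_inv τ := by ext; simp
  map_mul' σ τ := by ext; simp [RingAut.mul_apply]

theorem RingAut.conjEquiv_apply {L M : Type*} [Field L] [Field M] (Φ : L ≃+* M) (σ : RingAut L)
    (y : M) : RingAut.conjEquiv Φ σ y = Φ (σ (Φ.symm y)) := rfl

theorem RingAut.conjEquiv_symm_apply {L M : Type*} [Field L] [Field M] (Φ : L ≃+* M)
    (τ : RingAut M) (y : L) : (RingAut.conjEquiv Φ).symm τ y = Φ.symm (τ (Φ y)) := rfl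

theorem continuous_conjEquiv {L M : Type*} [Field L] [Field M] (Φ : L ≃+* M) :
    @Continuous _ _ (zariskiAut L) (zariskiAut M) (RingAut.conjEquiv Φ) := by
  let _ := zariskiAut L
  let _ := zariskiAut M
  refine continuous_generateFrom_iff.2 ?_
  rintro _ ⟨m, a, P, rfl⟩
  refine TopologicalSpace.isOpen_generateFrom_of_mem
    ⟨m, fun i => Φ.symm (a i), P.map (Φ.symm : M →+* L), ?_⟩
  ext σ
  have h : Φ (MvPolynomial.eval (fun i => σ (Φ.symm (a i))) (P.map (Φ.symm : M →+* L))) =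
      MvPolynomial.eval (fun i => Φ (σ (Φ.symm (a i)))) P := by
    rw [MvPolynomial.eval_map]
    have h := MvPolynomial.eval₂_comp_left (Φ : L →+* M) (Φ.symm : M →+* L)
      (fun i => σ (Φ.symm (a i))) P
    have h2 : (Φ : L →+* M).comp (Φ.symm : M →+* L) = RingHom.id M := by
      ext x; simp
    rw [h2] at h
    exact h
  simp only [Set.mem_preimage, Set.mem_ofPred_eq, RingAut.conjEquiv_apply, ne_eq]
  rw [← h, map_eq_zero_iff _ Φ.injective]

/-- Conjugation by `Φ` as a homeomorphism for the Zariski topologies. -/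
def RingAut.conjHomeomorph {L M : Type*} [Field L] [Field M] (Φ : L ≃+* M) :
    @Homeomorph (RingAut L) (RingAut M) (zariskiAut L) (zariskiAut M) :=
  letI := zariskiAut L
  letI := zariskiAut M
  { (RingAut.conjEquiv Φ).toEquiv with
    continuous_toFun := continuous_conjEquiv Φ
    continuous_invFun := continuous_conjEquiv Φ.symm }

theorem map_conjEquiv_identityComponent {L M : Type*} [Field L] [Field M] (Φ : L ≃+* M)
    (G : Subgroup (RingAut L)) :
    (identityComponent G).map (RingAut.conjEquiv Φ).toMonoidHom =
      identityComponent (G.map (RingAut.conjEquiv Φ).toMonoidHom) := by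
  let _ := zariskiAut L
  let _ := zariskiAut M
  apply SetLike.coe_injective
  have h := (RingAut.conjHomeomorph Φ).image_connectedComponentIn
    (s := (G : Set (RingAut L))) (x := 1) G.one_mem
  have h1 : RingAut.conjHomeomorph Φ 1 = 1 := map_one (RingAut.conjEquiv Φ)
  rw [h1] at h
  exact h

/-- If every element of `H` maps `s` to `s` or to `t ≠ s`, the stabilizer `G` of `s` in `H` is open
and closed in `H`, hence contains the identity component. -/
theorem identityComponent_stabilizer_eq {L : Type*} [Field L] {G H : Subgroup (RingAut L)}
    (s t : L) (hst : t ≠ s) (hG : ∀ σ, σ ∈ G ↔ σ ∈ H ∧ σ s = s)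
    (hH : ∀ σ ∈ H, σ s = s ∨ σ s = t) : identityComponent G = identityComponent H := by
  let _ := zariskiAut L
  have hGH : (G : Set (RingAut L)) ⊆ H := fun σ hσ => ((hG σ).1 hσ).1
  have hopen : ∀ x : L, IsOpen {σ : RingAut L | σ s ≠ x} := fun x =>
    TopologicalSpace.isOpen_generateFrom_of_mem
      ⟨1, fun _ => s, MvPolynomial.X 0 - MvPolynomial.C x, by
        ext σ; simp [sub_eq_zero]⟩
  apply SetLike.coe_injective
  change connectedComponentIn (G : Set (RingAut L)) 1 = connectedComponentIn (H : Set _) 1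
  refine (connectedComponentIn_mono 1 hGH).antisymm ?_
  have hpre : IsPreconnected (connectedComponentIn (H : Set (RingAut L)) 1) :=
    isPreconnected_connectedComponentIn
  refine hpre.subset_connectedComponentIn (mem_connectedComponentIn H.one_mem) fun σ hσ => ?_
  have hσH := connectedComponentIn_subset _ _ hσ
  refine (hG σ).2 ⟨hσH, ?_⟩
  -- on `H` the conditions `σ s = s` and `σ s = t` are complementary, and both are closed
  refine (hH σ hσH).resolve_right fun hσt => ?_
  obtain ⟨τ, hτ, hτt, hτs⟩ := hpre _ _ (hopen t) (hopen s)
    (fun τ _ => by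
      by_cases hτ : τ s = s
      · exact Or.inl fun h => hst (h.symm.trans hτ)
      · exact Or.inr hτ)
    ⟨1, mem_connectedComponentIn H.one_mem, hst.symm⟩ ⟨σ, hσ, fun h => hst (hσt.symm.trans h)⟩
  exact (hH τ (connectedComponentIn_subset _ _ hτ)).elim hτs hτt

/-! ### Differential Galois groups -/

theorem map_conjEquiv_DGal {L M : Type*} [Field L] [Algebra ℂ L] [Field M] [Algebra ℂ M]
    (Φ : L ≃+* M) {DL : Derivation ℂ L L} {DM : Derivation ℂ M M}
    (hΦ : ∀ y, Φ (DL y) = DM (Φ y)) {F : Subfield L} {F' : Subfield M}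
    (hF : ∀ a, a ∈ F ↔ Φ a ∈ F') :
    (DGal DL F).map (RingAut.conjEquiv Φ).toMonoidHom = DGal DM F' := by
  have hΦ' : ∀ y, Φ.symm (DM y) = DL (Φ.symm y) := fun y => by
    rw [RingEquiv.symm_apply_eq, hΦ, RingEquiv.apply_symm_apply]
  ext τ
  rw [Subgroup.mem_map_equiv]
  refine ⟨fun h => ⟨fun y => ?_, fun a ha => ?_⟩, fun h => ⟨fun y => ?_, fun a ha => ?_⟩⟩
  · have := congrArg Φ (h.1 (Φ.symm y))
    simpa [RingAut.conjEquiv_symm_apply, hΦ] using this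
  · have := congrArg Φ (h.2 (Φ.symm a) ((hF _).2 (by simpa using ha)))
    simpa [RingAut.conjEquiv_symm_apply] using this
  · rw [RingAut.conjEquiv_symm_apply, RingAut.conjEquiv_symm_apply, hΦ, h.1, hΦ']
  · rw [RingAut.conjEquiv_symm_apply, h.2 _ ((hF a).1 ha), RingEquiv.symm_apply_apply]

/-- The automorphisms over `K = F(s)` are those over `F` that fix `s`, for the derivation `DL` as
well as for its multiple by `s⁻¹`. -/
theorem mem_DGal_iff_of_adjoin_eq_top {F K L : Type*} [Field F] [Field K] [Algebra F K] [Field L]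
    [Algebra ℂ L] [Algebra K L] {s : K} (hs : s ≠ 0) (hK : IntermediateField.adjoin F {s} = ⊤)
    {DL δ : Derivation ℂ L L} (hδ : δ = (algebraMap K L s)⁻¹ • DL ∨ δ = DL) (σ : RingAut L) :
    σ ∈ DGal DL (algebraMap K L).fieldRange ↔
      σ ∈ DGal δ ((algebraMap K L).comp (algebraMap F K)).fieldRange ∧
        σ (algebraMap K L s) = algebraMap K L s := by
  have hs' : algebraMap K L s ≠ 0 := by simpa using hs
  have hcomm : σ (algebraMap K L s) = algebraMap K L s →
      ((∀ y, σ (DL y) = DL (σ y)) ↔ ∀ y, σ (δ y) = δ (σ y)) := by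
    intro h
    rcases hδ with rfl | rfl
    · simp [h, hs']
    · exact Iff.rfl
  constructor
  · intro h
    have h0 := h.2 _ ⟨s, rfl⟩
    refine ⟨⟨(hcomm h0).1 h.1, ?_⟩, h0⟩
    rintro _ ⟨a, rfl⟩
    exact h.2 _ ⟨algebraMap F K a, rfl⟩
  · rintro ⟨h, h0⟩
    refine ⟨(hcomm h0).2 h.1, ?_⟩
    rintro _ ⟨a, rfl⟩
    have ha : a ∈ IntermediateField.adjoin F {s} := hK ▸ IntermediateField.mem_top
    induction ha using IntermediateField.adjoin_induction with
    | mem x hx => rw [Set.mem_singleton_iff.1 hx]; exact h0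
    | algebraMap x => exact h.2 _ ⟨x, rfl⟩
    | add x y _ _ hx hy => simp only [map_add, hx, hy]
    | inv x _ hx => simp only [map_inv₀, hx]
    | mul x y _ _ hx hy => simp only [map_mul, hx, hy]

theorem identityComponent_DGal_eq {F K L : Type*} [Field F] [Field K] [Algebra F K] [Field L]
    [Algebra ℂ L] [Algebra K L] {s : K} (hs : s ≠ 0) (hK : IntermediateField.adjoin F {s} = ⊤)
    {a : F} (hsq : s ^ 2 = algebraMap F K a)
    {DL δ : Derivation ℂ L L} (hδ : δ = (algebraMap K L s)⁻¹ • DL ∨ δ = DL) :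
    identityComponent (DGal DL (algebraMap K L).fieldRange) =
      identityComponent (DGal δ ((algebraMap K L).comp (algebraMap F K)).fieldRange) := by
  have : CharZero L := charZero_of_injective_algebraMap (algebraMap ℂ L).injective
  have hs' : algebraMap K L s ≠ 0 := by simpa using hs
  refine identityComponent_stabilizer_eq (algebraMap K L s) (-algebraMap K L s)
    (neg_ne_self.2 hs') (mem_DGal_iff_of_adjoin_eq_top hs hK hδ) fun σ hσ => ?_
  rw [← sq_eq_sq_iff_eq_or_eq_neg, ← map_pow, ← map_pow, hsq]
  exact hσ.2 _ ⟨a, rfl⟩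

/-! ### Eigenrings -/

theorem map_mem_eigenring_iff {K K' : Type*} [Field K] [Algebra ℂ K] [Field K'] [Algebra ℂ K']
    (φ : K ≃ₐ[ℂ] K') {D : Derivation ℂ K K} {D' : Derivation ℂ K' K'}
    (hD : ∀ a, φ (D a) = D' (φ a)) {n : ℕ} (A P : Matrix (Fin n) (Fin n) K) :
    P.map φ ∈ eigenring D' (A.map φ) ↔ P ∈ eigenring D A := by
  change (P.map φ).map D' = P.map φ * A.map φ - A.map φ * P.map φ ↔ P.map D = P * A - A * P
  have h₁ : (P.map φ).map D' = (P.map D).map φ := by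
    ext i j
    exact (hD _).symm
  have h₂ : P.map φ * A.map φ - A.map φ * P.map φ = (P * A - A * P).map φ := by
    ext i j
    simp [Matrix.mul_apply]
  rw [h₁, h₂]
  exact (Matrix.map_injective φ.injective).eq_iff

/-- An isomorphism of differential fields `φ` maps the eigenring of a system isomorphically onto
the eigenring of its image, by applying `φ` to the entries of the matrices. -/
def eigenringEquiv {K K' : Type*} [Field K] [Algebra ℂ K] [Field K'] [Algebra ℂ K']
    (φ : K ≃ₐ[ℂ] K') {D : Derivation ℂ K K} {D' : Derivation ℂ K' K'}
    (hD : ∀ a, φ (D a) = D' (φ a)) {n : ℕ} (A : Matrix (Fin n) (Fin n) K) :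
    eigenring D A ≃ₐ[ℂ] eigenring D' (A.map φ) :=
  (φ.mapMatrix.subalgebraMap (eigenring D A)).trans (Subalgebra.equivOfEq _ _ (by
    ext P
    refine ⟨?_, fun hP => ⟨P.map φ.symm, ?_, by ext; simp⟩⟩
    · rintro ⟨Q, hQ, rfl⟩
      exact (map_mem_eigenring_iff φ hD A Q).2 hQ
    · refine (map_mem_eigenring_iff φ hD A _).1 ?_
      rwa [show (P.map φ.symm).map φ = P by ext; simp]))

/-! ### The comparison of the two systems -/

theorem theorem2p3p13
    -- the differential field `K = ℂ(z(x), ∂ₓ z(x))`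
    {K : Type*} [Field K] [Algebra ℂ K] (D : Derivation ℂ K K) (z : K)
    (hz : IsRationalHamiltonianChange D z)
    (hK : IntermediateField.adjoin ℂ {z, D z} = ⊤)
    (α : RatFunc ℂ) (hα : D z ^ 2 = ratEval z α)
    -- the field `K̂ = ℂ(z, √α)`, with the derivation `∂_z` that extends `d / dz`
    {Khat : Type*} [Field Khat] [Algebra ℂ Khat] [Algebra (RatFunc ℂ) Khat]
    [IsScalarTower ℂ (RatFunc ℂ) Khat]
    (s : Khat) (hs : s ^ 2 = algebraMap (RatFunc ℂ) Khat α)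
    (hKhat : IntermediateField.adjoin (RatFunc ℂ) {s} = ⊤)
    (dz : Derivation ℂ Khat Khat) (hdz : dz (algebraMap (RatFunc ℂ) Khat RatFunc.X) = 1)
    -- the root `s = √α` is the one that corresponds to `∂ₓ z`
    (hbranch : ∀ β : RatFunc ℂ, D z = ratEval z β → s = algebraMap (RatFunc ℂ) Khat β) :
    ∃ φ : K ≃ₐ[ℂ] Khat,
      φ z = algebraMap (RatFunc ℂ) Khat RatFunc.X ∧ φ (D z) = s ∧
      (∀ a, φ (D a) = (s • dz) (φ a)) ∧
      ∀ (n : ℕ) (A : Matrix (Fin n) (Fin n) K) (Ahat : Matrix (Fin n) (Fin n) Khat),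
        Ahat = A.map φ →
        (∀ (L : Type*) [Field L] [Algebra ℂ L] [Algebra K L] [IsScalarTower ℂ K L]
            (DL : Derivation ℂ L L)
            (Lhat : Type*) [Field Lhat] [Algebra ℂ Lhat] [Algebra Khat Lhat]
            [IsScalarTower ℂ Khat Lhat] (DLhat : Derivation ℂ Lhat Lhat),
            IsPicardVessiot D A DL → IsPicardVessiot (s • dz) Ahat DLhat →
            ∃ Φ : L ≃+* Lhat,
              (∀ a, Φ (algebraMap K L a) = algebraMap Khat Lhat (φ a)) ∧
              (∀ y, Φ (DL y) = DLhat (Φ y)) ∧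
              (∃ ψ : DGal DL (algebraMap K L).fieldRange ≃*
                  DGal DLhat (algebraMap Khat Lhat).fieldRange,
                ∀ σ y, (ψ σ).1 (Φ y) = Φ (σ.1 y)) ∧
              -- the group over `ℂ(z)`, for `δ = ∂_z` and for `δ = √α ∂_z`
              ∀ δ : Derivation ℂ Lhat Lhat,
                δ = (algebraMap Khat Lhat s)⁻¹ • DLhat ∨ δ = DLhat →
                DGal DLhat (algebraMap Khat Lhat).fieldRange ≤
                  DGal δ ((algebraMap Khat Lhat).comp (algebraMap (RatFunc ℂ) Khat)).fieldRange ∧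
                ∃ ψ₀ : identityComponent (DGal DL (algebraMap K L).fieldRange) ≃*
                    identityComponent (DGal δ
                      ((algebraMap Khat Lhat).comp (algebraMap (RatFunc ℂ) Khat)).fieldRange),
                  ∀ σ y, (ψ₀ σ).1 (Φ y) = Φ (σ.1 y)) ∧
        ∃ e : eigenring D A ≃ₐ[ℂ] eigenring (s • dz) Ahat,
          ∀ P, (e P).1 = P.1.map φ := by
  obtain ⟨φ, hφz, hφw, hφD⟩ :=
    exists_differential_algEquiv D hz.1 hK hα hs hKhat dz hdz hbranch
  refine ⟨φ, hφz, hφw, hφD, ?_⟩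
  rintro n A _ rfl
  refine ⟨?_, eigenringEquiv φ hφD A, fun P => rfl⟩
  intro L _ _ _ _ DL Lhat _ _ _ _ DLhat hL hLhat
  have hs0 : s ≠ 0 := by
    rw [← hφw]
    simpa using hz.1
  -- regard `Lhat` as an extension of `K` along `φ`
  let _ : Algebra K Lhat := ((algebraMap Khat Lhat).comp (φ : K →+* Khat)).toAlgebra
  have hmap : ∀ a, algebraMap K Lhat a = algebraMap Khat Lhat (φ a) := fun _ => rfl
  have : IsScalarTower ℂ K Lhat := IsScalarTower.of_algebraMap_eq fun c => by
    rw [hmap, AlgEquiv.commutes, ← IsScalarTower.algebraMap_apply]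
  obtain ⟨Φ, hΦ⟩ :=
    hL.exists_algEquiv (IsPicardVessiot.of_ringEquiv (φ : K ≃+* Khat) hmap hφD hLhat)
  have hΦK : ∀ a, Φ (algebraMap K L a) = algebraMap Khat Lhat (φ a) := fun a => Φ.commutes a
  have hconj := map_conjEquiv_DGal (Φ : L ≃+* Lhat) hΦ (F := (algebraMap K L).fieldRange)
    (F' := (algebraMap Khat Lhat).fieldRange) fun a => by
      constructor
      · rintro ⟨b, rfl⟩
        exact ⟨φ b, (hΦK b).symm⟩
      · rintro ⟨b, hb⟩
        refine ⟨φ.symm b, Φ.injective ?_⟩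
        rw [hΦK, AlgEquiv.apply_symm_apply]
        exact hb
  refine ⟨Φ, hΦK, hΦ, ⟨((RingAut.conjEquiv (Φ : L ≃+* Lhat)).subgroupMap _).trans
    (MulEquiv.subgroupCongr hconj), fun σ y => ?_⟩, fun δ hδ => ⟨fun σ hσ =>
      ((mem_DGal_iff_of_adjoin_eq_top hs0 hKhat hδ σ).1 hσ).1,
    ((RingAut.conjEquiv (Φ : L ≃+* Lhat)).subgroupMap _).trans (MulEquiv.subgroupCongr ?_),
    fun σ y => ?_⟩⟩
  · exact congrArg (fun x => Φ (σ.1 x)) (Φ.symm_apply_apply y)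
  · exact (map_conjEquiv_identityComponent _ _).trans
      ((congrArg identityComponent hconj).trans (identityComponent_DGal_eq hs0 hKhat hs hδ))
  · exact congrArg (fun x => Φ (σ.1 x)) (Φ.symm_apply_apply y)
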